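/- **Theorem A (Arbitrary speed exponents).** Let $\alpha\in[0,1]$. Then there exist a semigroup $S$ with identity element $1$, a finite set $T\subseteq S$ generating $S$ as a monoid, and a simple random walk $\{R_n\}_{n\ge 0}$ on $S$ with respect to $T$ (that is, $R_0=1$ and $R_n=X_1X_2\cdots X_n$, where $X_1,X_2,\dots$ are independent random variables, each uniformly distributed on $T$) such that $$\limsup_{n\to\infty}\,\log_n \mathbb{E}|R_n| = \alpha .$$ Here $|a|=\min\{k\ge 0 : a=t_1\cdots t_k \text{ for some } t_1,\dots,t_k\in T\}$ denotes the word length of $a\in S$ with respect to $T$, $\log_n z=\frac{\log z}{\log n}$, and $\log_n 0=-\infty$. -/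

import Mathlib

open MeasureTheory ProbabilityTheory Filter
open scoped ENNReal

namespace SemigroupWalk

/-- The word length `|a|` of `a` with respect to `T`: the least `k` such that `a` is a product
of `k` elements of `T` (the distance from `1` to `a` in the right Cayley graph).
The set below is nonempty for every `a` as soon as `T` generates the monoid. -/
noncomputable def wordLength {S : Type*} [Monoid S] (T : Finset S) (a : S) : ℕ :=
  sInf {k : ℕ | ∃ l : List S, l.length = k ∧ (∀ t ∈ l, t ∈ T) ∧ l.prod = a}

/-- `R` is a simple random walk on the monoid `S` with respect to the finite set `T`:
`R 0 = 1` and `R n = X 0 * X 1 * ⋯ * X (n - 1)`, where the steps `X i` are independent random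
variables, each of them uniformly distributed on `T`. -/
def IsSimpleRandomWalk {S Ω : Type*} [Monoid S] [MeasurableSpace S] [MeasurableSpace Ω]
    (T : Finset S) (P : Measure Ω) (R : ℕ → Ω → S) : Prop :=
  ∃ X : ℕ → Ω → S,
    (∀ i, Measurable (X i)) ∧
    iIndepFun X P ∧
    (∀ i, P.map (X i) = uniformOn (T : Set S)) ∧
    (∀ ω, R 0 ω = 1) ∧
    (∀ n ω, R (n + 1) ω = R n ω * X n ω)

/-- The speed function `n ↦ 𝔼 |R n|`. -/
noncomputable def speed {S Ω : Type*} [Monoid S] [MeasurableSpace Ω]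
    (T : Finset S) (P : Measure Ω) (R : ℕ → Ω → S) (n : ℕ) : ℝ≥0∞ :=
  ∫⁻ ω, (wordLength T (R n ω) : ℝ≥0∞) ∂P

/-- The speed exponent `limsup_{n → ∞} log_n 𝔼 |R n|`, as an extended real number
(`ENNReal.log 0 = -∞`, so no value is lost where the speed vanishes). -/
noncomputable def speedExponent {S Ω : Type*} [Monoid S] [MeasurableSpace Ω]
    (T : Finset S) (P : Measure Ω) (R : ℕ → Ω → S) : EReal :=
  limsup (fun n : ℕ => ENNReal.log (speed T P R n) / ((Real.log n : ℝ) : EReal)) atTop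

end SemigroupWalk

/-! Take words in two letters and remember, in every context, only the number of completed runs of
`true` of each length `r`, counted up to a cap `K r`. Repeated interior runs beyond the cap can be
deleted, so up to the final run and an additive 2 in the caps the length of a class is at most `∑ (r
+ 1) * min (K r) (number of runs of length r)`, while each capped count is a lower bound
(`wordLength_le`, `le_wordLength`). A uniform word of length `n` has about `n * 2 ^ (-r)` runs of
length `r`, up to a constant. With `K r ≈ 2 ^ (γ * r)`, cap and count balance at `2 ^ (r * (1 + γ))
= n`, so the mean length has exponent `γ / (1 + γ)`. Choosing `γ = α / (1 - α)` gives every `α < 1`;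
superexponential caps give `α = 1`. The upper bound holds at all large times
(`eventually_avg_wordLength_le`). The lower bound is needed only along times at which one cap is
half filled on average (`half_le_cappedAvg`, `frequently_le_avg_wordLength`), which suffices for a
limsup. -/

namespace CappedRuns

/-! ### Runs in binary words. -/

/-- The number of completed runs of `true` of length exactly `r` in a word (a run is completed by
a `false`), when the word is preceded by `j` further letters `true`. -/
def runCount (r : ℕ) : ℕ → List Bool → ℕ
  | _, [] => 0
  | j, true :: w => runCount r (j + 1) w
  | j, false :: w => (if j = r then 1 else 0) + runCount r 0 w

/-- The length of the final run of `true` of a word preceded by `j` further letters `true`. -/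
def lastRun : ℕ → List Bool → ℕ
  | j, [] => j
  | j, true :: w => lastRun (j + 1) w
  | _, false :: w => lastRun 0 w

theorem runCount_append (r : ℕ) (u v : List Bool) (j : ℕ) :
    runCount r j (u ++ v) = runCount r j u + runCount r (lastRun j u) v := by
  induction u generalizing j with
  | nil => simp [runCount, lastRun]
  | cons c u ih => cases c <;> simp [runCount, lastRun, ih, add_assoc]

theorem lastRun_append (u v : List Bool) (j : ℕ) :
    lastRun j (u ++ v) = lastRun (lastRun j u) v := by
  induction u generalizing j with
  | nil => rfl
  | cons c u ih => cases c <;> simp [lastRun, ih]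

theorem runCount_le_length (r j : ℕ) (w : List Bool) : runCount r j w ≤ w.length := by
  induction w generalizing j with
  | nil => simp [runCount]
  | cons c w ih =>
    cases c
    · have := ih 0
      simp only [runCount, List.length_cons]
      split_ifs <;> omega
    · have := ih (j + 1)
      simp only [runCount, List.length_cons]
      omega

/-- The preceding letters can alter only the first completed run. -/
theorem runCount_le_add_one (r j j' : ℕ) (w : List Bool) :
    runCount r j w ≤ runCount r j' w + 1 := by
  induction w generalizing j j' with
  | nil => simp [runCount]
  | cons c w ih =>
    cases c
    · simp only [runCount]
      split_ifs <;> omega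
    · exact ih _ _

theorem runCount_replicate (r j k : ℕ) (w : List Bool) :
    runCount r j (List.replicate k true ++ w) = runCount r (j + k) w := by
  induction k generalizing j with
  | zero => simp
  | succ k ih => simp [List.replicate_succ, runCount, ih, add_assoc, add_comm 1]

theorem exists_of_runCount_pos (r j : ℕ) (w : List Bool) (h : 0 < runCount r j w) :
    (∃ q, w = List.replicate (r - j) true ++ false :: q ∧ j ≤ r) ∨
      ∃ p q, w = p ++ false :: (List.replicate r true ++ false :: q) := by
  induction w generalizing j with
  | nil => simp [runCount] at h
  | cons c w ih =>
    cases c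
    · by_cases hj : j = r
      · exact Or.inl ⟨w, by simp [hj], hj.le⟩
      · simp only [runCount, hj, if_false, zero_add] at h
        rcases ih 0 h with ⟨q, hq, -⟩ | ⟨p, q, hq⟩
        · exact Or.inr ⟨[], q, by simpa using hq⟩
        · exact Or.inr ⟨false :: p, q, by simp [hq]⟩
    · rcases ih (j + 1) h with ⟨q, hq, hj⟩ | ⟨p, q, hq⟩
      · refine Or.inl ⟨q, ?_, by omega⟩
        rw [show r - j = r - (j + 1) + 1 by omega, List.replicate_succ, hq]
        rfl
      · exact Or.inr ⟨true :: p, q, by simp [hq]⟩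

/-- Only the initial run is not preceded by a `false` of the word, so one of any two runs is
interior. An interior run keeps its length in every context, which makes it safe to delete. -/
theorem exists_interior_run (r : ℕ) (w : List Bool) (h : 2 ≤ runCount r 0 w) :
    ∃ p q, w = p ++ false :: (List.replicate r true ++ false :: q) := by
  rcases exists_of_runCount_pos r 0 w (by omega) with ⟨q, hq, -⟩ | h'
  · have hq' : 0 < runCount r 0 q := by
      rw [hq, runCount_replicate] at h
      simp only [runCount] at h
      split_ifs at h <;> omega
    rcases exists_of_runCount_pos r 0 q hq' with ⟨q', hq'', -⟩ | ⟨p, q', hq''⟩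
    · exact ⟨List.replicate r true, q', by simpa [hq''] using hq⟩
    · exact ⟨List.replicate r true ++ false :: p, q', by simpa [hq''] using hq⟩
  · exact h'

theorem runCount_interior (s r j : ℕ) (p q : List Bool) :
    runCount s j (p ++ false :: (List.replicate r true ++ false :: q)) =
      runCount s j (p ++ false :: q) + if r = s then 1 else 0 := by
  rw [runCount_append, runCount_append]
  simp only [runCount, runCount_replicate, zero_add]
  omega

/-- A completed run of length `r` accounts for `r + 1` letters, its closing `false` included; `hm`
keeps all run lengths below `m`. -/
theorem length_add_eq (m j : ℕ) (w : List Bool) (hm : j + w.length < m) :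
    j + w.length = lastRun j w + ∑ r ∈ Finset.range m, (r + 1) * runCount r j w := by
  induction w generalizing j with
  | nil => simp [runCount, lastRun]
  | cons c w ih =>
    simp only [List.length_cons] at hm ⊢
    cases c
    · have := ih 0 (by omega)
      simp only [runCount, lastRun, mul_add, Finset.sum_add_distrib, mul_ite, mul_one, mul_zero,
        Finset.sum_ite_eq, Finset.mem_range]
      rw [if_pos (by omega)]
      omega
    · have := ih (j + 1) (by omega)
      simp only [runCount, lastRun]
      omega

/-! ### The monoid of capped runs and its word length. -/

/-- Two words are congruent if they cannot be told apart, in any context, by the numbers of runs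
of each length `r`, counted up to `K r`. -/
def cappedCon (K : ℕ → ℕ) : Con (FreeMonoid Bool) where
  r w w' := ∀ (u v : FreeMonoid Bool) (r : ℕ),
    min (K r) (runCount r 0 (u * w * v).toList) = min (K r) (runCount r 0 (u * w' * v).toList)
  iseqv := ⟨fun _ _ _ _ => rfl, fun h u v r => (h u v r).symm,
    fun h h' u v r => (h u v r).trans (h' u v r)⟩
  mul' {w w' x x'} h h' u v r := by
    have h1 := h u (x * v) r
    have h2 := h' (u * w') v r
    simp only [mul_assoc] at h1 h2 ⊢
    exact h1.trans h2

/-- A context on the left can destroy at most one of the runs counted in `h`, so at least `K r`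
survive in any context and the cap hides the deleted one. -/
theorem cappedCon_delete_run {K : ℕ → ℕ} {r : ℕ} {p q : List Bool}
    (h : K r < runCount r 0 (p ++ false :: q)) :
    cappedCon K (FreeMonoid.ofList (p ++ false :: (List.replicate r true ++ false :: q)))
      (FreeMonoid.ofList (p ++ false :: q)) := by
  intro u v s
  have key : runCount s 0 (u * FreeMonoid.ofList (p ++ false :: (List.replicate r true ++ false :: q))
      * v).toList = runCount s 0 (u * FreeMonoid.ofList (p ++ false :: q) * v).toList +
        if r = s then 1 else 0 := by
    have := runCount_interior s r 0 (u.toList ++ p) (q ++ v.toList)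
    simpa [FreeMonoid.toList_mul] using this
  rw [key]
  split_ifs with hs
  · subst hs
    have h1 := runCount_append r u.toList (p ++ false :: q ++ v.toList) 0
    have h2 := runCount_append r (p ++ false :: q) v.toList (lastRun 0 u.toList)
    have h3 := runCount_le_add_one r 0 (lastRun 0 u.toList) (p ++ false :: q)
    have h4 : (u * FreeMonoid.ofList (p ++ false :: q) * v).toList =
        u.toList ++ (p ++ false :: q ++ v.toList) := by
      simp [FreeMonoid.toList_mul]
    rw [h4]
    omega
  · rfl

/-- Interior runs are deleted one at a time. A count above `K r + 2` ensures both that an interior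
run exists and that more than `K r` runs remain after its deletion. -/
theorem exists_reduced (K : ℕ → ℕ) (w : List Bool) :
    ∃ w' : List Bool, cappedCon K (FreeMonoid.ofList w) (FreeMonoid.ofList w') ∧
      w'.length ≤ w.length ∧ lastRun 0 w' = lastRun 0 w ∧
      ∀ r, runCount r 0 w' ≤ min (K r + 2) (runCount r 0 w) := by
  induction hn : w.length using Nat.strong_induction_on generalizing w with
  | _ n ih =>
    by_cases h : ∀ r, runCount r 0 w ≤ K r + 2
    · exact ⟨w, (cappedCon K).refl _, hn.le, rfl, fun r => le_min (h r) le_rfl⟩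
    · push Not at h
      obtain ⟨r, hr⟩ := h
      obtain ⟨p, q, rfl⟩ := exists_interior_run r w (by omega)
      have hint := fun s => runCount_interior s r 0 p q
      obtain ⟨w', h1, h2, h3, h4⟩ := ih (p ++ false :: q).length
        (by rw [← hn]; simp) (p ++ false :: q) rfl
      refine ⟨w', (cappedCon K).trans (cappedCon_delete_run ?_) h1, ?_, ?_, fun s => ?_⟩
      · have := hint r
        simp only [if_true] at this
        omega
      · refine h2.trans ?_
        rw [← hn]
        simp
        omega
      · rw [h3]
        simp only [lastRun_append, lastRun]
      · have := hint s
        have := h4 s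
        omega

/-- The monoid of words modulo `cappedCon K`. -/
abbrev CappedMonoid (K : ℕ → ℕ) : Type := (cappedCon K).Quotient

/-- The class of a word. -/
def word (K : ℕ → ℕ) (w : List Bool) : CappedMonoid K :=
  ((FreeMonoid.ofList w : FreeMonoid Bool) : (cappedCon K).Quotient)

theorem word_append (K : ℕ → ℕ) (u v : List Bool) : word K (u ++ v) = word K u * word K v := rfl

theorem word_nil (K : ℕ → ℕ) : word K [] = 1 := rfl

theorem word_surjective (K : ℕ → ℕ) : Function.Surjective (word K) := fun x =>
  Con.induction_on x fun w => ⟨w.toList, rfl⟩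

theorem prod_map_word (K : ℕ → ℕ) (w : List Bool) :
    (w.map fun c => word K [c]).prod = word K w := by
  induction w with
  | nil => rfl
  | cons c w ih => rw [List.map_cons, List.prod_cons, ih, ← word_append]; rfl

theorem min_runCount_eq {K : ℕ → ℕ} {w w' : List Bool} (h : word K w = word K w') (r : ℕ) :
    min (K r) (runCount r 0 w) = min (K r) (runCount r 0 w') := by
  have := (Con.eq (cappedCon K)).1 h 1 1 r
  simpa using this

open Classical in
/-- The two generators of the monoid of capped runs. -/
noncomputable def gens (K : ℕ → ℕ) : Finset (CappedMonoid K) :=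
  {word K [true], word K [false]}

theorem word_mem_gens (K : ℕ → ℕ) (c : Bool) : word K [c] ∈ gens K := by
  cases c <;> simp [gens]

theorem exists_word_of_mem {K : ℕ → ℕ} (l : List (CappedMonoid K)) (hl : ∀ t ∈ l, t ∈ gens K) :
    ∃ w : List Bool, w.length = l.length ∧ word K w = l.prod := by
  induction l with
  | nil => exact ⟨[], rfl, rfl⟩
  | cons t l ih =>
    obtain ⟨w, h1, h2⟩ := ih fun t ht => hl t (List.mem_cons_of_mem _ ht)
    have ht : ∃ c, word K [c] = t := by
      have := hl t List.mem_cons_self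
      simp only [gens, Finset.mem_insert, Finset.mem_singleton] at this
      rcases this with rfl | rfl
      exacts [⟨_, rfl⟩, ⟨_, rfl⟩]
    obtain ⟨c, rfl⟩ := ht
    exact ⟨c :: w, by simp [h1], by rw [List.prod_cons, ← h2, ← word_append]; rfl⟩

theorem closure_gens (K : ℕ → ℕ) : Submonoid.closure (gens K : Set (CappedMonoid K)) = ⊤ := by
  refine top_unique fun x _ => ?_
  obtain ⟨w, rfl⟩ := word_surjective K x
  rw [← prod_map_word]
  refine Submonoid.list_prod_mem _ fun t ht => Submonoid.subset_closure ?_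
  obtain ⟨c, -, rfl⟩ := List.mem_map.1 ht
  exact word_mem_gens K c

/-- A single `false` completes a run of length 0, and a single `true` completes none. Distinctness
gives each generator probability one half. -/
theorem gens_ne {K : ℕ → ℕ} (hK : ∀ r, 0 < K r) : word K [true] ≠ word K [false] := by
  intro h
  have := min_runCount_eq h 0
  have := hK 0
  simp [runCount] at *
  omega

theorem wordLength_le_length (K : ℕ → ℕ) (w : List Bool) :
    SemigroupWalk.wordLength (gens K) (word K w) ≤ w.length := by
  refine Nat.sInf_le ⟨w.map fun c => word K [c], by simp, fun t ht => ?_, prod_map_word K w⟩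
  obtain ⟨c, -, rfl⟩ := List.mem_map.1 ht
  exact word_mem_gens K c

theorem wordLength_le (K : ℕ → ℕ) (w : List Bool) :
    SemigroupWalk.wordLength (gens K) (word K w) ≤
      lastRun 0 w + ∑ r ∈ Finset.range (w.length + 1), (r + 1) * min (K r + 2) (runCount r 0 w) := by
  obtain ⟨w', h1, h2, h3, h4⟩ := exists_reduced K w
  have h5 : word K w = word K w' := (Con.eq _).2 h1
  rw [h5]
  refine (wordLength_le_length K w').trans ?_
  have := length_add_eq (w.length + 1) 0 w' (by omega)
  rw [zero_add] at this
  rw [this, h3]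
  gcongr with r
  exact h4 r

/-- The capped count is an invariant of the class, and no representative has more runs than letters.
-/
theorem le_wordLength (K : ℕ → ℕ) (w : List Bool) (r : ℕ) :
    min (K r) (runCount r 0 w) ≤ SemigroupWalk.wordLength (gens K) (word K w) := by
  refine le_csInf ⟨w.length, w.map fun c => word K [c], by simp, fun t ht => ?_,
    prod_map_word K w⟩ ?_
  · obtain ⟨c, -, rfl⟩ := List.mem_map.1 ht
    exact word_mem_gens K c
  · rintro k ⟨l, rfl, hl, hw⟩
    obtain ⟨w', h1, h2⟩ := exists_word_of_mem l hl
    rw [min_runCount_eq (hw.symm.trans h2.symm) r, ← h1]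
    exact (min_le_right _ _).trans (runCount_le_length r 0 w')

/-! ### Averages over words and the upper bound for the mean length. -/

/-- The average of `g` over the words of length `n`. -/
noncomputable def avg : ℕ → (List Bool → ℝ) → ℝ
  | 0, g => g []
  | n + 1, g => (avg n (fun w => g (true :: w)) + avg n (fun w => g (false :: w))) / 2

theorem avg_mono {n : ℕ} {f g : List Bool → ℝ} (h : ∀ w, w.length = n → f w ≤ g w) :
    avg n f ≤ avg n g := by
  induction n generalizing f g with
  | zero => exact h [] rfl
  | succ n ih =>
    have h1 := ih (f := fun w => f (true :: w)) (g := fun w => g (true :: w))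
      fun w hw => h _ (by simp [hw])
    have h2 := ih (f := fun w => f (false :: w)) (g := fun w => g (false :: w))
      fun w hw => h _ (by simp [hw])
    simp only [avg]
    linarith

theorem avg_const (n : ℕ) (c : ℝ) : avg n (fun _ => c) = c := by
  induction n with
  | zero => rfl
  | succ n ih => simp only [avg, ih]; ring

theorem avg_add (n : ℕ) (f g : List Bool → ℝ) :
    avg n (fun w => f w + g w) = avg n f + avg n g := by
  induction n generalizing f g with
  | zero => rfl
  | succ n ih => simp only [avg, ih]; ring

theorem avg_const_mul (n : ℕ) (c : ℝ) (f : List Bool → ℝ) :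
    avg n (fun w => c * f w) = c * avg n f := by
  induction n generalizing f with
  | zero => rfl
  | succ n ih => simp only [avg, ih]; ring

theorem avg_sum {ι : Type*} (n : ℕ) (s : Finset ι) (f : ι → List Bool → ℝ) :
    avg n (fun w => ∑ i ∈ s, f i w) = ∑ i ∈ s, avg n (f i) := by
  classical
  induction s using Finset.induction_on with
  | empty => simp [avg_const]
  | insert i s hi ih => simp only [Finset.sum_insert hi, avg_add, ih]

theorem avg_min_le (n : ℕ) (c : ℝ) (f : List Bool → ℝ) :
    avg n (fun w => min c (f w)) ≤ min c (avg n f) :=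
  le_min ((avg_mono fun _ _ => min_le_left _ _).trans (avg_const n c).le)
    (avg_mono fun _ _ => min_le_right _ _)

theorem avg_append (m n : ℕ) (g : List Bool → ℝ) :
    avg (m + n) g = avg m fun u => avg n fun v => g (u ++ v) := by
  induction m generalizing g with
  | zero => simp [avg]
  | succ m ih => simp only [Nat.succ_add, avg, ih, List.cons_append]

theorem avg_indicator (v₀ : List Bool) :
    avg v₀.length (fun v => if v = v₀ then 1 else 0) = (1 / 2) ^ v₀.length := by
  induction v₀ with
  | nil => simp [avg]
  | cons c v₀ ih =>
    cases c <;> simp [avg, avg_const] at ih ⊢ <;> rw [ih] <;> ring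

/-- Induction on the first letter. The last term bounds the contribution of the run already begun,
which needs `r - j` more letters `true`. -/
theorem avg_runCount_le (r n j : ℕ) :
    avg n (fun w => (runCount r j w : ℝ)) ≤
      n * (1 / 2) ^ r + if j ≤ r then (1 / 2) ^ (r - j) else 0 := by
  induction n generalizing j with
  | zero => simp only [avg, runCount]; split_ifs <;> simp
  | succ n ih =>
    have h1 := ih (j + 1)
    have h2 := ih 0
    simp only [zero_le, if_true, Nat.sub_zero] at h2
    simp only [avg, runCount, Nat.cast_add, avg_add, avg_const]
    push_cast
    have hp : (0 : ℝ) < (1 / 2) ^ r := by positivity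
    rcases lt_trichotomy j r with hj | hj | hj
    · rw [if_pos (by omega)] at h1
      rw [if_pos hj.le, if_neg hj.ne]
      have : ((1 : ℝ) / 2) ^ (r - j) = (1 / 2) ^ (r - (j + 1)) / 2 := by
        rw [show r - j = r - (j + 1) + 1 by omega, pow_succ]; ring
      rw [this]
      linarith
    · subst hj
      rw [if_neg (by omega)] at h1
      simp only [Nat.sub_self, pow_zero, if_true, le_refl, add_zero] at h1 ⊢
      linarith
    · rw [if_neg (by omega)] at h1
      rw [if_neg (by omega), if_neg (by omega)]
      linarith

theorem avg_lastRun (n j : ℕ) :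
    avg n (fun w => (lastRun j w : ℝ)) = 1 + (1 / 2) ^ n * (j - 1) := by
  induction n generalizing j with
  | zero => simp [avg, lastRun]
  | succ n ih =>
    simp only [avg, lastRun, ih]
    push_cast
    ring

theorem avg_wordLength_le (K : ℕ → ℕ) (n : ℕ) :
    avg n (fun w => (SemigroupWalk.wordLength (gens K) (word K w) : ℝ)) ≤
      1 + ∑ r ∈ Finset.range (n + 1), ((r : ℝ) + 1) * min ((K r : ℝ) + 2) (((n : ℝ) + 1) * (1 / 2) ^ r) := by
  have h1 : avg n (fun w => (SemigroupWalk.wordLength (gens K) (word K w) : ℝ)) ≤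
      avg n (fun w => (lastRun 0 w : ℝ) + ∑ r ∈ Finset.range (n + 1),
        ((r : ℝ) + 1) * min ((K r : ℝ) + 2) (runCount r 0 w : ℝ)) := by
    refine avg_mono fun w hw => ?_
    have := wordLength_le K w
    rw [hw] at this
    exact_mod_cast this
  refine h1.trans ?_
  rw [avg_add, avg_sum, avg_lastRun]
  simp only [avg_const_mul]
  have hp : (0 : ℝ) < (1 / 2) ^ n := by positivity
  refine add_le_add (by push_cast; linarith) (Finset.sum_le_sum fun r _ => ?_)
  gcongr
  refine (avg_min_le _ _ _).trans (min_le_min le_rfl ?_)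
  have := avg_runCount_le r n 0
  simp only [zero_le, if_true, Nat.sub_zero] at this
  linarith

/-! ### Filling one cap: the lower bound for the mean length. -/

/-- The average over words of length `n` of the number of runs of length `r` counted up to `k`. -/
noncomputable def cappedAvg (k r n : ℕ) : ℝ := avg n fun w => min (k : ℝ) (runCount r 0 w)

/-- A fresh block of `r + 2` letters is `false`, `r` times `true`, `false` with probability `(1 / 2)
^ (r + 2)`, and then completes a new run whatever came before. The gain is 1 below the cap and 0 at
it, hence at least `1 - count / k`; this bound is affine in the capped count, so the recursion
closes on averages. -/
theorem cappedAvg_step {k : ℕ} (hk : 0 < k) (r n : ℕ) :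
    cappedAvg k r n + (1 / 2) ^ (r + 2) * (1 - cappedAvg k r n / k) ≤
      cappedAvg k r (n + (r + 2)) := by
  set v₀ : List Bool := false :: (List.replicate r true ++ [false]) with hv₀
  have hlen : v₀.length = r + 2 := by simp [hv₀]
  have hk' : (0 : ℝ) < k := by exact_mod_cast hk
  have key : ∀ u v : List Bool, min (k : ℝ) (runCount r 0 u) +
      (1 - (k : ℝ)⁻¹ * min (k : ℝ) (runCount r 0 u)) * (if v = v₀ then 1 else 0) ≤
        min (k : ℝ) (runCount r 0 (u ++ v)) := by
    intro u v
    split_ifs with hv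
    · have h1 : runCount r 0 u + 1 ≤ runCount r 0 (u ++ v) := by
        rw [runCount_append, hv, hv₀]
        simp only [runCount, runCount_replicate, zero_add, if_true]
        omega
      rcases le_or_gt k (runCount r 0 u) with h | h
      · have h2 : (k : ℝ) ≤ runCount r 0 u := by exact_mod_cast h
        have h3 : (k : ℝ) ≤ runCount r 0 (u ++ v) := by exact_mod_cast (by omega)
        rw [min_eq_left h2, min_eq_left h3, inv_mul_cancel₀ hk'.ne']
        simp
      · have h2 : (runCount r 0 u : ℝ) + 1 ≤ k := by exact_mod_cast h
        have h3 : (runCount r 0 u : ℝ) + 1 ≤ runCount r 0 (u ++ v) := by exact_mod_cast h1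
        have h4 : (0 : ℝ) ≤ (k : ℝ)⁻¹ * runCount r 0 u := by positivity
        rw [min_eq_right (by linarith : (runCount r 0 u : ℝ) ≤ k)]
        refine le_min ?_ ?_ <;> linarith
    · have h1 : (runCount r 0 u : ℝ) ≤ runCount r 0 (u ++ v) := by
        rw [runCount_append]; push_cast; linarith [(runCount r (lastRun 0 u) v).cast_nonneg (α := ℝ)]
      rw [mul_zero, add_zero]
      exact min_le_min le_rfl h1
  have h : avg n (fun u => min (k : ℝ) (runCount r 0 u) + ((1 / 2) ^ (r + 2) +
      (-((1 / 2) ^ (r + 2) * (k : ℝ)⁻¹)) * min (k : ℝ) (runCount r 0 u))) ≤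
        cappedAvg k r (n + (r + 2)) := by
    rw [cappedAvg, avg_append]
    refine avg_mono fun u _ => ?_
    refine le_trans (le_of_eq ?_) (avg_mono fun v _ => key u v)
    rw [avg_add, avg_const, avg_const_mul, ← hlen, avg_indicator]
    ring
  rw [avg_add, avg_add, avg_const, avg_const_mul] at h
  refine le_trans (le_of_eq ?_) h
  rw [cappedAvg]
  ring

/-- By `cappedAvg_step`, each block contracts the deficit below the cap by a fixed factor. -/
theorem sub_cappedAvg_le {k : ℕ} (hk : 0 < k) (r m : ℕ) :
    k - cappedAvg k r (m * (r + 2)) ≤ (1 - (1 / 2) ^ (r + 2) / k) ^ m * k := by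
  have hk' : (0 : ℝ) < k := by exact_mod_cast hk
  have hk1 : (1 : ℝ) ≤ k := by exact_mod_cast hk
  induction m with
  | zero => simp [cappedAvg, avg, runCount]
  | succ m ih =>
    have h := cappedAvg_step hk r (m * (r + 2))
    rw [Nat.succ_mul, pow_succ]
    have hq : 0 ≤ 1 - (1 / 2 : ℝ) ^ (r + 2) / k := by
      have : (1 / 2 : ℝ) ^ (r + 2) ≤ 1 := pow_le_one₀ (by norm_num) (by norm_num)
      have := div_le_one_of_le₀ (this.trans hk1) hk'.le
      linarith
    have := mul_le_mul_of_nonneg_left ih hq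
    have e : (1 - (1 / 2 : ℝ) ^ (r + 2) / k) * (k - cappedAvg k r (m * (r + 2))) =
        k - (cappedAvg k r (m * (r + 2)) + (1 / 2) ^ (r + 2) *
          (1 - cappedAvg k r (m * (r + 2)) / k)) := by
      field_simp
      ring
    linarith

/-- With `N = k * 2 ^ (r + 2)` blocks the contraction is `(1 - 1 / N) ^ N ≤ exp (-1) ≤ 1 / 2`. -/
theorem half_le_cappedAvg {k : ℕ} (hk : 0 < k) (r : ℕ) :
    (k : ℝ) / 2 ≤ cappedAvg k r (k * 2 ^ (r + 2) * (r + 2)) := by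
  have hk' : (0 : ℝ) < k := by exact_mod_cast hk
  have h := sub_cappedAvg_le hk r (k * 2 ^ (r + 2))
  have h1 : (1 - (1 / 2 : ℝ) ^ (r + 2) / k) ^ (k * 2 ^ (r + 2)) ≤ Real.exp (-1) := by
    have := Real.one_sub_div_pow_le_exp_neg (n := k * 2 ^ (r + 2)) (t := 1)
      (by exact_mod_cast Nat.one_le_iff_ne_zero.2 (by positivity))
    refine le_trans (le_of_eq ?_) this
    congr 2
    push_cast
    rw [one_div_pow]
    field_simp
  have h2 : Real.exp (-1) ≤ 1 / 2 := by
    have := Real.add_one_le_exp (1 : ℝ)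
    rw [Real.exp_neg, one_div]
    exact inv_anti₀ (by norm_num) (by linarith)
  have := mul_le_mul_of_nonneg_right (h1.trans h2) hk'.le
  linarith

theorem half_le_avg_wordLength {K : ℕ → ℕ} (hK : ∀ r, 0 < K r) (r : ℕ) :
    (K r : ℝ) / 2 ≤ avg (K r * 2 ^ (r + 2) * (r + 2))
      (fun w => (SemigroupWalk.wordLength (gens K) (word K w) : ℝ)) := by
  refine (half_le_cappedAvg (hK r) r).trans (avg_mono fun w _ => ?_)
  exact_mod_cast le_wordLength K w r

/-! ### The random walk and its law. -/

instance (K : ℕ → ℕ) : MeasurableSpace (CappedMonoid K) := ⊤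

instance (K : ℕ → ℕ) : DiscreteMeasurableSpace (CappedMonoid K) := ⟨fun _ => trivial⟩

instance (K : ℕ → ℕ) : Countable (CappedMonoid K) := (word_surjective K).countable

theorem lintegral_uniformOn_gens {K : ℕ → ℕ} (hK : ∀ r, 0 < K r) (g : CappedMonoid K → ℝ≥0∞) :
    ∫⁻ x, g x ∂(uniformOn (gens K : Set (CappedMonoid K))) =
      (g (word K [true]) + g (word K [false])) / 2 := by
  classical
  have hc : (gens K).card = 2 := by
    rw [gens, Finset.card_pair (gens_ne hK)]
  rw [uniformOn, ProbabilityTheory.cond, lintegral_smul_measure, lintegral_finset, Measure.count_apply_finset, hc]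
  simp only [Measure.count_singleton, mul_one]
  rw [gens, Finset.sum_pair (gens_ne hK), smul_eq_mul, mul_comm, div_eq_mul_inv]
  rfl

theorem indepFun_walk {S Ω : Type*} [Monoid S] [Countable S] [MeasurableSpace S]
    [DiscreteMeasurableSpace S] [MeasurableSpace Ω] {P : Measure Ω} {X R : ℕ → Ω → S}
    (hX : ∀ i, Measurable (X i)) (hind : iIndepFun X P) (h0 : ∀ ω, R 0 ω = 1)
    (hR : ∀ n ω, R (n + 1) ω = R n ω * X n ω) (n : ℕ) : IndepFun (R n) (X n) P := by
  have h := indep_iSup_of_disjoint (m := fun i => MeasurableSpace.comap (X i) inferInstance)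
    (fun i => (hX i).comap_le) hind (S := Set.Iio n) (T := {n}) (by simp)
  have hmeas : ∀ k ≤ n, Measurable[⨆ i ∈ Set.Iio n, MeasurableSpace.comap (X i) inferInstance]
      (R k) := by
    intro k
    induction k with
    | zero =>
      intro _
      rw [show R 0 = fun _ => 1 from funext h0]
      exact measurable_const
    | succ k ih =>
      intro hk
      rw [show R (k + 1) = fun ω => R k ω * X k ω from funext (hR k)]
      refine Measurable.mul (ih (by omega)) ?_
      have h1 : MeasurableSpace.comap (X k) inferInstance ≤
          ⨆ i ∈ Set.Iio n, MeasurableSpace.comap (X i) inferInstance :=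
        le_iSup₂_of_le k (Set.mem_Iio.2 hk) le_rfl
      exact (comap_measurable (X k)).mono h1 le_rfl
  rw [iSup_singleton] at h
  exact indep_of_indep_of_le_left h (hmeas n le_rfl).comap_le

theorem lintegral_walk {K : ℕ → ℕ} (hK : ∀ r, 0 < K r) {Ω : Type*} [MeasurableSpace Ω]
    {P : Measure Ω} [IsProbabilityMeasure P] {R : ℕ → Ω → CappedMonoid K}
    (hR : SemigroupWalk.IsSimpleRandomWalk (gens K) P R) (n : ℕ) (g : CappedMonoid K → ℝ)
    (hg : ∀ x, 0 ≤ g x) :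
    ∫⁻ ω, ENNReal.ofReal (g (R n ω)) ∂P = ENNReal.ofReal (avg n fun w => g (word K w)) := by
  obtain ⟨X, hX, hind, hlaw, h0, hs⟩ := hR
  have hmR : ∀ k, Measurable (R k) := by
    intro k
    induction k with
    | zero => rw [show R 0 = fun _ => 1 from funext h0]; exact measurable_const
    | succ k ih => rw [show R (k + 1) = fun ω => R k ω * X k ω from funext (hs k)]; exact ih.mul (hX k)
  induction n generalizing g with
  | zero => simp [h0, avg, word_nil]
  | succ n ih =>
    have hi := (indepFun_iff_map_prod_eq_prod_map_map (hmR n).aemeasurable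
      (hX n).aemeasurable).1 (indepFun_walk hX hind h0 hs n)
    have : IsProbabilityMeasure (P.map (X n)) := Measure.isProbabilityMeasure_map (hX n).aemeasurable
    have hf : Measurable fun p : CappedMonoid K × CappedMonoid K => ENNReal.ofReal (g (p.1 * p.2)) :=
      Measurable.of_discrete
    calc ∫⁻ ω, ENNReal.ofReal (g (R (n + 1) ω)) ∂P
        = ∫⁻ p, ENNReal.ofReal (g (p.1 * p.2)) ∂(P.map fun ω => (R n ω, X n ω)) := by
          rw [lintegral_map hf ((hmR n).prodMk (hX n))]
          simp only [hs]
      _ = ∫⁻ ω, ENNReal.ofReal ((g (R n ω * word K [true]) + g (R n ω * word K [false])) / 2) ∂P := by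
          rw [hi, lintegral_prod _ hf.aemeasurable, lintegral_map Measurable.of_discrete (hmR n)]
          refine lintegral_congr fun ω => ?_
          simp only []
          rw [hlaw, lintegral_uniformOn_gens hK, ENNReal.ofReal_div_of_pos two_pos,
            ENNReal.ofReal_add (hg _) (hg _), ENNReal.ofReal_ofNat]
      _ = _ := by
          -- The walk appends letters on the right, whereas `avg` recurses on the first letter;
          -- splitting off the last letter reconciles them.
          rw [ih (fun x => (g (x * word K [true]) + g (x * word K [false])) / 2)
            fun x => div_nonneg (add_nonneg (hg _) (hg _)) two_pos.le, avg_append n 1]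
          rfl

theorem speed_eq {K : ℕ → ℕ} (hK : ∀ r, 0 < K r) {Ω : Type*} [MeasurableSpace Ω]
    {P : Measure Ω} [IsProbabilityMeasure P] {R : ℕ → Ω → CappedMonoid K}
    (hR : SemigroupWalk.IsSimpleRandomWalk (gens K) P R) (n : ℕ) :
    SemigroupWalk.speed (gens K) P R n = ENNReal.ofReal (avg n fun w =>
      (SemigroupWalk.wordLength (gens K) (word K w) : ℝ)) := by
  rw [← lintegral_walk hK hR n (fun x => (SemigroupWalk.wordLength (gens K) x : ℝ))
    fun x => Nat.cast_nonneg _]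
  simp [SemigroupWalk.speed]

theorem exists_walk (K : ℕ → ℕ) :
    ∃ (Ω : Type) (_ : MeasurableSpace Ω) (P : Measure Ω) (_ : IsProbabilityMeasure P)
      (R : ℕ → Ω → CappedMonoid K), SemigroupWalk.IsSimpleRandomWalk (gens K) P R := by
  have : IsProbabilityMeasure (uniformOn (gens K : Set (CappedMonoid K))) :=
    isProbabilityMeasure_uniformOn (gens K).finite_toSet ⟨_, word_mem_gens K true⟩
  refine ⟨ℕ → CappedMonoid K, inferInstance,
    Measure.infinitePi fun _ => uniformOn (gens K : Set (CappedMonoid K)), inferInstance,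
    fun n ω => ((List.range n).map ω).prod, fun i ω => ω i, fun i => measurable_pi_apply i,
    iIndepFun_infinitePi (X := fun _ x => x) fun _ => measurable_id, fun i => ?_, fun ω => rfl,
    fun n ω => ?_⟩
  · exact Measure.infinitePi_map_eval _ i
  · simp [List.range_succ]

/-! ### Exponents and the choice of caps. -/

theorem min_le_rpow_mul_rpow {x y β : ℝ} (hx : 0 < x) (hy : 0 < y) (h0 : 0 ≤ β) (h1 : β ≤ 1) :
    min x y ≤ x ^ (1 - β) * y ^ β := by
  have hm : 0 < min x y := lt_min hx hy
  calc min x y = min x y ^ (1 - β) * min x y ^ β := by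
        rw [← Real.rpow_add hm, sub_add_cancel, Real.rpow_one]
    _ ≤ _ := by
        gcongr
        · exact min_le_left _ _
        · exact min_le_right _ _

/-- Bounding the minimum by a weighted geometric mean avoids splitting the sum at the critical `r`:
the terms become geometric, with ratio below 1 exactly when `β > γ / (1 + γ)` (for `γ ≥ 0`). -/
theorem min_capped_le {γ β : ℝ} (h0 : 0 ≤ β) (h1 : β ≤ 1) {n r : ℕ} (hn : 0 < n) :
    min (4 * (2 : ℝ) ^ (γ * r)) (((n : ℝ) + 1) * (1 / 2) ^ r) ≤
      4 * (n : ℝ) ^ β * ((2 : ℝ) ^ (γ * (1 - β) - β)) ^ r := by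
  have hn' : (1 : ℝ) ≤ n := by exact_mod_cast hn
  have hle : ((n : ℝ) + 1) * (1 / 2) ^ r ≤ 4 * (n * (2 : ℝ) ^ (-(r : ℝ))) := by
    rw [Real.rpow_neg two_pos.le, Real.rpow_natCast, one_div, inv_pow, ← mul_assoc]
    gcongr
    linarith
  calc min (4 * (2 : ℝ) ^ (γ * r)) (((n : ℝ) + 1) * (1 / 2) ^ r)
      ≤ min (4 * (2 : ℝ) ^ (γ * r)) (4 * (n * (2 : ℝ) ^ (-(r : ℝ)))) := min_le_min le_rfl hle
    _ = 4 * min ((2 : ℝ) ^ (γ * r)) (n * (2 : ℝ) ^ (-(r : ℝ))) :=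
        (mul_min_of_nonneg _ _ (by norm_num)).symm
    _ ≤ 4 * (((2 : ℝ) ^ (γ * r)) ^ (1 - β) * (n * (2 : ℝ) ^ (-(r : ℝ))) ^ β) := by
        gcongr
        exact min_le_rpow_mul_rpow (by positivity) (by positivity) h0 h1
    _ = _ := by
        rw [Real.mul_rpow (by positivity) (by positivity), ← Real.rpow_mul two_pos.le,
          ← Real.rpow_mul two_pos.le, ← Real.rpow_natCast, ← Real.rpow_mul two_pos.le,
          show (γ * (1 - β) - β) * (r : ℝ) = γ * r * (1 - β) + -r * β by ring,
          Real.rpow_add two_pos]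
        ring

theorem exists_avg_wordLength_le {K : ℕ → ℕ} {γ β : ℝ}
    (hγ : ∀ r : ℕ, (K r : ℝ) + 2 ≤ 4 * (2 : ℝ) ^ (γ * r))
    (h0 : 0 ≤ β) (h1 : β ≤ 1) (hβ : γ * (1 - β) < β) :
    ∃ C : ℝ, ∀ n : ℕ, 0 < n →
      avg n (fun w => (SemigroupWalk.wordLength (gens K) (word K w) : ℝ)) ≤ C * (n : ℝ) ^ β := by
  set q : ℝ := (2 : ℝ) ^ (γ * (1 - β) - β) with hq
  have hq0 : 0 < q := by positivity
  have hq1 : q < 1 := Real.rpow_lt_one_of_one_lt_of_neg one_lt_two (by linarith)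
  have hsum : Summable fun r : ℕ => ((r : ℝ) + 1) * q ^ r := by
    have hq' : ‖q‖ < 1 := by rwa [Real.norm_of_nonneg hq0.le]
    have h := (summable_pow_mul_geometric_of_norm_lt_one 1 hq').add
      (summable_geometric_of_norm_lt_one hq')
    refine h.congr fun r => ?_
    ring
  refine ⟨1 + 4 * ∑' r : ℕ, ((r : ℝ) + 1) * q ^ r, fun n hn => ?_⟩
  have hn1 : (1 : ℝ) ≤ (n : ℝ) ^ β := Real.one_le_rpow (by exact_mod_cast hn) h0
  calc _ ≤ _ := avg_wordLength_le K n
    _ ≤ 1 + ∑ r ∈ Finset.range (n + 1), 4 * (n : ℝ) ^ β * (((r : ℝ) + 1) * q ^ r) := by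
        gcongr 1 + ∑ r ∈ _, ?_ with r
        have := (min_le_min (hγ r) le_rfl).trans (min_capped_le (γ := γ) (r := r) h0 h1 hn)
        calc _ ≤ ((r : ℝ) + 1) * (4 * (n : ℝ) ^ β * q ^ r) := by gcongr
          _ = _ := by ring
    _ ≤ 1 + 4 * (n : ℝ) ^ β * ∑' r : ℕ, ((r : ℝ) + 1) * q ^ r := by
        rw [← Finset.mul_sum]
        gcongr
        exact hsum.sum_le_tsum _ fun r _ => by positivity
    _ ≤ _ := by
        rw [add_mul]
        linarith

theorem eventually_avg_wordLength_le {K : ℕ → ℕ} {γ : ℝ} (hγ0 : 0 ≤ γ)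
    (hγ : ∀ r : ℕ, (K r : ℝ) + 2 ≤ 4 * (2 : ℝ) ^ (γ * r)) {β : ℝ} (hβ : γ / (1 + γ) < β) :
    ∀ᶠ n : ℕ in atTop,
      avg n (fun w => (SemigroupWalk.wordLength (gens K) (word K w) : ℝ)) ≤ (n : ℝ) ^ β := by
  have hα : γ / (1 + γ) < 1 := by rw [div_lt_one (by linarith)]; linarith
  -- An exponent below `β` leaves a factor `n ^ (β - β')` to absorb the constant `C`; `β' < 1` is
  -- needed for a geometric mean.
  obtain ⟨β', h1, h2⟩ := exists_between (lt_min hβ hα)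
  have h3 : 0 ≤ β' := (div_nonneg hγ0 (by linarith)).trans h1.le
  obtain ⟨C, hC⟩ := exists_avg_wordLength_le hγ h3 (h2.le.trans (min_le_right _ _))
    (by rw [div_lt_iff₀ (by linarith)] at h1; linarith)
  have ht : Tendsto (fun n : ℕ => (n : ℝ) ^ (β - β')) atTop atTop :=
    (tendsto_rpow_atTop (sub_pos.2 (h2.trans_le (min_le_left _ _)))).comp tendsto_natCast_atTop_atTop
  filter_upwards [ht.eventually_ge_atTop C, eventually_gt_atTop 0] with n hn hn0
  have hn' : (0 : ℝ) < n := by exact_mod_cast hn0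
  calc _ ≤ C * (n : ℝ) ^ β' := hC n hn0
    _ ≤ (n : ℝ) ^ (β - β') * (n : ℝ) ^ β' := by gcongr
    _ = _ := by rw [← Real.rpow_add hn', sub_add_cancel]

theorem frequently_le_avg_wordLength {K : ℕ → ℕ} (hK : ∀ r, 0 < K r) {γ β : ℝ} (hβ1 : β ≤ 1)
    (hβ : β < (1 - β) * γ) (hγ : ∀ᶠ r : ℕ in atTop, (2 : ℝ) ^ (γ * r) ≤ K r) :
    ∃ᶠ n : ℕ in atTop,
      (n : ℝ) ^ β ≤ avg n (fun w => (SemigroupWalk.wordLength (gens K) (word K w) : ℝ)) := by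
  have hl2 : 0 < Real.log 2 := Real.log_pos one_lt_two
  -- At `n = K r * 2 ^ (r + 2) * (r + 2)`, taking logarithms in `n ^ β ≤ K r / 2` leaves a margin `δ
  -- * r` against constants and `β * log (r + 2)`.
  set δ : ℝ := ((1 - β) * γ - β) * Real.log 2 with hδ
  have hδ0 : 0 < δ := mul_pos (by linarith) hl2
  have hlo : (fun x : ℝ => (Real.log 2 + 2 * β * Real.log 2) + β * Real.log x) =o[atTop] (id : ℝ → ℝ) :=
    (Asymptotics.isLittleO_const_id_atTop _).add (Real.isLittleO_log_id_atTop.const_mul_left β)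
  have hev : ∀ᶠ r : ℕ in atTop, (Real.log 2 + 2 * β * Real.log 2) + β * Real.log ((r : ℝ) + 2) ≤
      δ / 2 * ((r : ℝ) + 2) := by
    have ht : Tendsto (fun r : ℕ => (r : ℝ) + 2) atTop atTop :=
      tendsto_atTop_add_const_right _ _ tendsto_natCast_atTop_atTop
    filter_upwards [ht.eventually (hlo.bound (half_pos hδ0))] with r hr
    refine (le_abs_self _).trans (hr.trans_eq ?_)
    rw [id, Real.norm_of_nonneg (by positivity)]
  refine frequently_atTop.2 fun N => ?_
  obtain ⟨r, hr1, hr2, hr3, hrN⟩ := (hev.and (hγ.and ((eventually_ge_atTop 2).and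
    (eventually_ge_atTop N)))).exists
  have hKr : (0 : ℝ) < K r := by exact_mod_cast hK r
  refine ⟨K r * 2 ^ (r + 2) * (r + 2), ?_, ?_⟩
  · have : 1 ≤ K r * 2 ^ (r + 2) := Nat.mul_pos (hK r) (by positivity)
    nlinarith
  refine le_trans ?_ (half_le_avg_wordLength hK r)
  have hlogK : γ * r * Real.log 2 ≤ Real.log (K r) := by
    rw [← Real.log_rpow two_pos]
    exact Real.log_le_log (by positivity) hr2
  have hr3' : (2 : ℝ) ≤ r := by exact_mod_cast hr3
  rw [← Real.log_le_log_iff (by have := hK r; positivity) (by positivity),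
    Real.log_rpow (by have := hK r; positivity), Real.log_div hKr.ne' two_ne_zero]
  push_cast
  rw [Real.log_mul (by positivity) (by positivity), Real.log_mul (by positivity) (by positivity),
    Real.log_pow]
  push_cast
  have h4 := mul_le_mul_of_nonneg_left hlogK (sub_nonneg.2 hβ1)
  have h5 : δ / 2 * ((r : ℝ) + 2) ≤ δ * r := by nlinarith
  have h6 : δ * r = (1 - β) * (γ * r * Real.log 2) - β * r * Real.log 2 := by rw [hδ]; ring
  nlinarith

theorem speedExponent_eq {K : ℕ → ℕ} (hK : ∀ r, 0 < K r) {α : ℝ}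
    (hU : ∀ β > α, ∀ᶠ n : ℕ in atTop,
      avg n (fun w => (SemigroupWalk.wordLength (gens K) (word K w) : ℝ)) ≤ (n : ℝ) ^ β)
    (hL : ∀ β < α, ∃ᶠ n : ℕ in atTop,
      (n : ℝ) ^ β ≤ avg n (fun w => (SemigroupWalk.wordLength (gens K) (word K w) : ℝ)))
    {Ω : Type*} [MeasurableSpace Ω] {P : Measure Ω} [IsProbabilityMeasure P]
    {R : ℕ → Ω → CappedMonoid K} (hR : SemigroupWalk.IsSimpleRandomWalk (gens K) P R) :
    SemigroupWalk.speedExponent (gens K) P R = (α : EReal) := by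
  -- For `n < 2` the denominator `log n` vanishes, so these times are discarded.
  have hlog : ∀ n : ℕ, 2 ≤ n → ∀ β : ℝ,
      ENNReal.log (ENNReal.ofReal ((n : ℝ) ^ β)) / ((Real.log n : ℝ) : EReal) = (β : EReal) := by
    intro n hn β
    have hn' : (1 : ℝ) < n := by exact_mod_cast hn
    rw [ENNReal.log_ofReal_of_pos (by positivity), Real.log_rpow (by linarith), ← EReal.coe_div,
      mul_div_cancel_right₀ _ (Real.log_pos hn').ne']
  have hpos : ∀ n : ℕ, 2 ≤ n → (0 : EReal) ≤ ((Real.log n : ℝ) : EReal) := fun n _ =>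
    EReal.coe_nonneg.2 (Real.log_natCast_nonneg n)
  rw [SemigroupWalk.speedExponent]
  simp only [speed_eq hK hR]
  refine le_antisymm ?_ ?_
  · refine EReal.le_of_forall_lt_iff_le.1 fun β hβ => ?_
    refine limsup_le_of_le (by isBoundedDefault) ?_
    filter_upwards [hU β (EReal.coe_lt_coe_iff.1 hβ), eventually_ge_atTop 2] with n hn h2
    rw [← hlog n h2 β]
    exact EReal.div_le_div_right_of_nonneg (hpos n h2)
      (ENNReal.log_monotone (ENNReal.ofReal_le_ofReal hn))
  · refine EReal.ge_of_forall_gt_iff_ge.1 fun β hβ => ?_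
    refine le_limsup_of_frequently_le ?_ (by isBoundedDefault)
    refine ((hL β (EReal.coe_lt_coe_iff.1 hβ)).and_eventually (eventually_ge_atTop 2)).mono ?_
    rintro n ⟨hn, h2⟩
    rw [← hlog n h2 β]
    exact EReal.div_le_div_right_of_nonneg (hpos n h2)
      (ENNReal.log_monotone (ENNReal.ofReal_le_ofReal hn))

theorem exists_caps (α : ℝ) (hα : α ∈ Set.Icc (0 : ℝ) 1) :
    ∃ K : ℕ → ℕ, (∀ r, 0 < K r) ∧
      (∀ β > α, ∀ᶠ n : ℕ in atTop,
        avg n (fun w => (SemigroupWalk.wordLength (gens K) (word K w) : ℝ)) ≤ (n : ℝ) ^ β) ∧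
      ∀ β < α, ∃ᶠ n : ℕ in atTop,
        (n : ℝ) ^ β ≤ avg n (fun w => (SemigroupWalk.wordLength (gens K) (word K w) : ℝ)) := by
  obtain ⟨h0, h1⟩ := hα
  rcases h1.lt_or_eq with h1 | rfl
  · have h1' : 0 < 1 - α := sub_pos.2 h1
    set γ : ℝ := α / (1 - α) with hγ
    have hγ0 : 0 ≤ γ := div_nonneg h0 h1'.le
    have hγα : γ / (1 + γ) = α := by rw [hγ]; field_simp; ring
    have hγ' : γ * (1 - α) = α := div_mul_cancel₀ _ h1'.ne'
    have hK : ∀ r : ℕ, 0 < ⌈(2 : ℝ) ^ (γ * r)⌉₊ := fun r => Nat.ceil_pos.2 (by positivity)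
    refine ⟨fun r => ⌈(2 : ℝ) ^ (γ * r)⌉₊, hK, fun β hβ => ?_, fun β hβ => ?_⟩
    · refine eventually_avg_wordLength_le hγ0 (fun r => ?_) (hγα.trans_lt hβ)
      -- For `x ≥ 1`, `⌈x⌉₊ + 2 < x + 3 ≤ 4 * x`, the source of the factor 4.
      have h2 : (1 : ℝ) ≤ (2 : ℝ) ^ (γ * r) := Real.one_le_rpow one_le_two (by positivity)
      have h3 := Nat.ceil_lt_add_one (zero_le_one.trans h2)
      linarith
    · refine frequently_le_avg_wordLength (γ := γ) hK (hβ.trans h1).le ?_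
        (Eventually.of_forall fun r => Nat.le_ceil _)
      nlinarith
  -- For `α = 1` these caps eventually exceed `2 ^ (γ * r)` for every `γ`, and the upper bound is
  -- just that length is at most `n`.
  · refine ⟨fun r => 2 ^ r ^ 2, fun r => by positivity, fun β hβ => ?_, fun β hβ => ?_⟩
    · filter_upwards [eventually_ge_atTop 1] with n hn
      have hn' : (1 : ℝ) ≤ n := by exact_mod_cast hn
      calc _ ≤ avg n fun _ => (n : ℝ) :=
            avg_mono fun w hw => by
              exact_mod_cast (wordLength_le_length _ w).trans hw.le
        _ = (n : ℝ) ^ (1 : ℝ) := by rw [avg_const, Real.rpow_one]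
        _ ≤ _ := Real.rpow_le_rpow_of_exponent_le hn' hβ.le
    · have hβ' : 0 < 1 - β := sub_pos.2 hβ
      -- This `γ` gives `(1 - β) * γ = β + (1 - β) > β`.
      refine frequently_le_avg_wordLength (γ := β / (1 - β) + 1) (fun r => by positivity) hβ.le
        ?_ ?_
      · rw [mul_add, mul_div_cancel₀ _ hβ'.ne']
        linarith
      · filter_upwards [tendsto_natCast_atTop_atTop.eventually_ge_atTop (β / (1 - β) + 1)] with r hr
        push_cast
        rw [← Real.rpow_natCast]
        refine Real.rpow_le_rpow_of_exponent_le one_le_two ?_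
        push_cast
        rw [sq]
        gcongr

end CappedRuns

theorem theoremA (α : ℝ) (hα : α ∈ Set.Icc (0 : ℝ) 1) :
    ∃ (S : Type) (_ : Monoid S) (_ : MeasurableSpace S) (_ : DiscreteMeasurableSpace S)
      (T : Finset S) (Ω : Type) (_ : MeasurableSpace Ω) (P : Measure Ω)
      (_ : IsProbabilityMeasure P) (R : ℕ → Ω → S),
      Submonoid.closure (T : Set S) = ⊤ ∧
      SemigroupWalk.IsSimpleRandomWalk T P R ∧
      SemigroupWalk.speedExponent T P R = (α : EReal) := by
  obtain ⟨K, hK, hU, hL⟩ := CappedRuns.exists_caps α hα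
  obtain ⟨Ω, _, P, _, R, hR⟩ := CappedRuns.exists_walk K
  exact ⟨CappedRuns.CappedMonoid K, inferInstance, inferInstance, inferInstance,
    CappedRuns.gens K, Ω, inferInstance, P, inferInstance, R, CappedRuns.closure_gens K, hR,
    CappedRuns.speedExponent_eq hK hU hL hR⟩
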